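/- Let $S\subseteq(0,1)$ be dense in $(0,1)$, with the partial operation $x\dotplus y=x+y$, defined if and only if $x+y\in S$. For $x\in S$ put $R(x)=\{s\in S: x\dotplus s\text{ is defined}\}$, and for a non-empty finite $H\subseteq S$ put $R(H)=\bigcap_{x\in H}R(x)$. Suppose that $(S,\dotplus)$ is a partially near zero semigroup, that is, an adequate partial semigroup: $S\ne\emptyset$; for all $x,y,z\in S$, if one of $(x\dotplus y)\dotplus z$ and $x\dotplus(y\dotplus z)$ is defined, then so is the other and they are equal; and $R(H)\neq\emptyset$ for every non-empty finite $H\subseteq S$. Suppose further that $R(x)=(0,1-x)\cap S$ for every $x\in S$ (equivalently, $x+y\in S$ whenever $x,y\in S$ and $x+y<1$). Let $\delta S$ be the set of all ultrafilters on $S$ that contain $R(H)$ for every non-empty finite $H\subseteq S$. It is a semigroup under $$p\dotplus q=\{B\subseteq S:\{a\in S:\{t\in R(a): a\dotplus t\in B\}\in q\}\in p\},$$ and $K(\delta S)$ denotes its smallest two-sided ideal. A set $A\subseteq S$ is piecewise syndetic if $A\in p$ for some $p\in K(\delta S)$, i.e. $\overline A\cap K(\delta S)\neq\emptyset$. A sequence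 $f:\mathbb N\to S$ is a partial sequence if $\sum_{t\in H}f(t)\in(0,1)$ for every non-empty finite $H\subseteq\mathbb N$. A set $A\subseteq S$ is a partial $J$-set if for any finitely many partial sequences $f_1,\dots,f_k:\mathbb N\to S$ there are a non-empty finite set $F\subseteq\mathbb N$ and an $a\in S$ such that, for every $i=1,\dots,k$, one has $\sum_{t\in F}f_i(t)\in S$, $a\in R\bigl(\sum_{t\in F}f_i(t)\bigr)$ and $a\dotplus\sum_{t\in F}f_i(t)\in A$. Theorem. Every piecewise syndetic subset $A$ of $S$ is a partial $J$-set. -/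

import Mathlib

namespace NearZero

/-! ### Partial semigroups

A partial binary operation on `α` is a map `op : α → α → Part α`; `op x y` is defined
when `(op x y).Dom` holds. -/

/-- `(α, op)` is a partial semigroup: `α` is non-empty, and if one of `(x * y) * z` and
`x * (y * z)` is defined then so is the other and they are equal. -/
structure IsPartialSemigroup {α : Type*} (op : α → α → Part α) : Prop where
  nonempty : Nonempty α
  assoc : ∀ x y z : α,
    ((op x y).bind fun w => op w z) = ((op y z).bind fun w => op x w)

/-- `R(x) = {s : x * s is defined}`. -/
def R {α : Type*} (op : α → α → Part α) (x : α) : Set α := {s | (op x s).Dom}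

/-- `R(H) = ⋂_{x ∈ H} R(x)`. -/
def RFin {α : Type*} (op : α → α → Part α) (H : Finset α) : Set α := ⋂ x ∈ H, R op x

/-- `(α, op)` is adequate: `R(H) ≠ ∅` for every non-empty finite `H`. -/
def IsAdequate {α : Type*} (op : α → α → Part α) : Prop :=
  ∀ H : Finset α, H.Nonempty → (RFin op H).Nonempty

/-- `δα`, the set of ultrafilters that contain `R(H)` for every non-empty finite `H`. -/
def delta {α : Type*} (op : α → α → Part α) : Set (Ultrafilter α) :=
  {p | ∀ H : Finset α, H.Nonempty → RFin op H ∈ p}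

/-- `s⁻¹A = {t ∈ R(s) : s * t ∈ A}`. -/
def leftQuot {α : Type*} (op : α → α → Part α) (s : α) (A : Set α) : Set α :=
  {t | ∃ c ∈ op s t, c ∈ A}

theorem R_mem_of_mem_delta {α : Type*} {op : α → α → Part α} {q : Ultrafilter α}
    (hq : q ∈ delta op) (a : α) : R op a ∈ q := by
  simpa [RFin] using hq {a} (Finset.singleton_nonempty a)

/-- For `q ∈ δα`, the ultrafilter `p * q = {A : {a : a⁻¹A ∈ q} ∈ p}`. -/
def ultraMul {α : Type*} (op : α → α → Part α) (p q : Ultrafilter α) (hq : q ∈ delta op) :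
    Ultrafilter α :=
  Ultrafilter.ofComplNotMemIff
    { sets := {A | {a | leftQuot op a A ∈ q} ∈ p}
      univ_sets := by
        refine Filter.mem_of_superset Filter.univ_mem fun a _ => ?_
        refine Filter.mem_of_superset (R_mem_of_mem_delta hq a) fun t ht => ?_
        exact ⟨(op a t).get ht, Part.get_mem ht, trivial⟩
      sets_of_superset := by
        intro A B hA hAB
        refine Filter.mem_of_superset hA fun a ha => ?_
        refine Filter.mem_of_superset ha ?_
        rintro t ⟨c, hc, hcA⟩
        exact ⟨c, hc, hAB hcA⟩
      inter_sets := by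
        intro A B hA hB
        refine Filter.mem_of_superset (Filter.inter_mem hA hB) ?_
        rintro a ⟨ha, hb⟩
        refine Filter.mem_of_superset (Filter.inter_mem ha hb) ?_
        rintro t ⟨⟨c, hc, hcA⟩, ⟨d, hd, hdB⟩⟩
        exact ⟨c, hc, hcA, (Part.mem_unique hc hd) ▸ hdB⟩ }
    (by
      intro A
      have key : {a | leftQuot op a Aᶜ ∈ q} = {a | leftQuot op a A ∈ q}ᶜ := by
        ext a
        have hR := R_mem_of_mem_delta hq a
        simp only [Set.mem_ofPred_eq, Set.mem_compl_iff, ← Ultrafilter.compl_mem_iff_notMem]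
        constructor
        · intro h
          refine Filter.mem_of_superset h ?_
          rintro t ⟨c, hc, hcA⟩ ⟨d, hd, hdA⟩
          exact hcA ((Part.mem_unique hd hc) ▸ hdA)
        · intro h
          refine Filter.mem_of_superset (Filter.inter_mem h hR) ?_
          rintro t ⟨ht, htR⟩
          exact ⟨(op a t).get htR, Part.get_mem htR,
            fun hA => ht ⟨(op a t).get htR, Part.get_mem htR, hA⟩⟩
      change {a | leftQuot op a Aᶜ ∈ q} ∉ p ↔ {a | leftQuot op a A ∈ q} ∈ p
      rw [key, Ultrafilter.compl_notMem_iff])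

theorem mem_ultraMul {α : Type*} {op : α → α → Part α} {p q : Ultrafilter α}
    {hq : q ∈ delta op} {A : Set α} :
    A ∈ ultraMul op p q hq ↔ {a | leftQuot op a A ∈ q} ∈ p := Iff.rfl

theorem ultraMul_mem_delta {α : Type*} {op : α → α → Part α} (h : IsPartialSemigroup op)
    {p q : Ultrafilter α} (hp : p ∈ delta op) (hq : q ∈ delta op) :
    ultraMul op p q hq ∈ delta op := by
  intro H _
  rw [RFin, ← Ultrafilter.mem_coe, Filter.biInter_finset_mem]
  intro x _
  change R op x ∈ ultraMul op p q hq
  rw [mem_ultraMul]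
  refine Filter.mem_of_superset (R_mem_of_mem_delta hp x) fun a ha => ?_
  -- `x * a` is defined, and for almost all `t` so are `(x * a) * t` and `a * t`
  refine Filter.mem_of_superset (R_mem_of_mem_delta hq ((op x a).get ha)) fun t ht => ?_
  have h1 : (op ((op x a).get ha) t).get ht ∈ (op x a).bind fun w => op w t :=
    Part.mem_bind (Part.get_mem ha) (Part.get_mem ht)
  rw [h.assoc] at h1
  obtain ⟨w, hw, hxw⟩ := Part.mem_bind_iff.1 h1
  exact ⟨w, hw, Part.dom_iff_mem.2 ⟨_, hxw⟩⟩

/-- The operation of `δα`. -/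
def deltaMul {α : Type*} {op : α → α → Part α} (h : IsPartialSemigroup op)
    (p q : delta op) : delta op :=
  ⟨ultraMul op p.1 q.1 q.2, ultraMul_mem_delta h p.2 q.2⟩

/-- `I` is a (two-sided) ideal of `(M, mul)`. -/
def IsIdeal {M : Type*} (mul : M → M → M) (I : Set M) : Prop :=
  I.Nonempty ∧ ∀ x ∈ I, ∀ y : M, mul y x ∈ I ∧ mul x y ∈ I

/-- `K(M)`, the smallest ideal of `(M, mul)`, as the intersection of all its ideals. -/
def smallestIdeal {M : Type*} (mul : M → M → M) : Set M := ⋂₀ {I | IsIdeal mul I}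

/-- `A` is piecewise syndetic: the closure of `A` in the space of ultrafilters, which is
`{p : A ∈ p}`, meets `K(δα)`. -/
def IsPiecewiseSyndetic {α : Type*} {op : α → α → Part α} (h : IsPartialSemigroup op)
    (A : Set α) : Prop :=
  ∃ p ∈ smallestIdeal (deltaMul h), A ∈ p.1

/-! ### Subsets of the unit interval -/

/-- The partial operation on `S ⊆ ℝ`: `x ∔ y = x + y`, defined if and only if `x + y ∈ S`. -/
def dotAdd (S : Set ℝ) (x y : S) : Part S :=
  ⟨(x : ℝ) + y ∈ S, fun h => ⟨(x : ℝ) + y, h⟩⟩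

/-- `(S, ∔)` is a partially near zero semigroup. -/
structure IsPartiallyNearZero (S : Set ℝ) : Prop where
  subset : S ⊆ Set.Ioo 0 1
  isPartialSemigroup : IsPartialSemigroup (dotAdd S)
  isAdequate : IsAdequate (dotAdd S)
  dense : Set.Ioo 0 1 ⊆ closure S

/-- `f : ℕ → S` is a partial sequence: all its finite sums lie in `(0,1)`. -/
def IsPartialSequence {S : Set ℝ} (f : ℕ → S) : Prop :=
  ∀ H : Finset ℕ, H.Nonempty → ∑ t ∈ H, (f t : ℝ) ∈ Set.Ioo (0 : ℝ) 1

/-- `A ⊆ S` is a partial `J`-set: for any partial sequences `f₁, …, f_k` in `S` there are a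
non-empty finite `F` and an `a ∈ S` such that, for every `i`, the sum `s = ∑_{t ∈ F} f_i(t)` is
an element of `S`, `a ∈ R(s)`, and `a ∔ s ∈ A`. -/
def IsPartialJSet {S : Set ℝ} (A : Set S) : Prop :=
  ∀ (k : ℕ) (f : Fin k → ℕ → S), (∀ i, IsPartialSequence (f i)) →
    ∃ F : Finset ℕ, F.Nonempty ∧ ∃ a : S, ∀ i, ∃ s : S, (s : ℝ) = ∑ t ∈ F, (f i t : ℝ) ∧
      a ∈ R (dotAdd S) s ∧ ∃ b ∈ dotAdd S a s, b ∈ A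

end NearZero

/-!
The smallest ideal `K(δS)` is contained in every ideal of `δS`, so it is enough to show that the
ultrafilters in `δS` all of whose members are partial `J`-sets form an ideal.

That this set absorbs products on both sides is a direct computation
(`hasTranslates_mem_ultraMul_left` and `hasTranslates_mem_ultraMul_right`). That it is non-empty
rests on two facts. First, partial `J`-sets are partition regular
(`HasTranslates.or_of_union`): apply the Hales–Jewett theorem to the words `w` over an alphabet
indexing a finite family `h` of partial sequences, coloured according to the piece which contains
the translate of the mixed sequence `t ↦ ∑ j, h (w j) (φ (t, j))`, where `φ` is an injection into
a tail of `ℕ`. A partial sequence is summable, so on a late enough tail these mixed sequences are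
partial sequences as well. Second, `S ∩ (0, ε)` is a partial `J`-set for each `ε > 0`
(`hasTranslates_of_Ioo`), again because partial sequences are summable. Hence the filter of sets
with non-`J` complement is compatible with the neighbourhoods of `0`, and an ultrafilter finer
than both has only partial `J`-sets as members and belongs to `δS`.
-/

namespace NearZero

open Filter Topology

variable {S : Set ℝ}

/-- The combinatorial content of being a partial `J`-set, for families indexed by an arbitrary
finite type: some translate of the sums of the family over a common index set lies in `A`. When
`S` is closed under sums less than `1`, the definedness clauses of `IsPartialJSet` are automatic,
see `HasTranslates.isPartialJSet`. -/
def HasTranslates (A : Set S) : Prop :=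
  ∀ (ι : Type) [Fintype ι] (f : ι → ℕ → S), (∀ i, IsPartialSequence (f i)) →
    ∃ F : Finset ℕ, F.Nonempty ∧ ∃ a : S, ∀ i, ∃ b ∈ A, (b : ℝ) = a + ∑ t ∈ F, (f i t : ℝ)

/-- `S` is closed under those sums which are less than `1`. -/
def AddClosedBelowOne (S : Set ℝ) : Prop :=
  ∀ x ∈ S, ∀ y ∈ S, x + y < 1 → x + y ∈ S

theorem HasTranslates.mono {A B : Set S} (hA : HasTranslates A) (hAB : A ⊆ B) :
    HasTranslates B := by
  intro ι _ f hf
  obtain ⟨F, hF, a, h⟩ := hA ι f hf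
  exact ⟨F, hF, a, fun i => let ⟨b, hb, hb'⟩ := h i; ⟨b, hAB hb, hb'⟩⟩

/-! ### Sums of elements of `S` -/

theorem add_sum_mem (hadd : AddClosedBelowOne S) (hS : S ⊆ Set.Ioo 0 1) {κ : Type*}
    (s : Finset κ) (f : κ → S) {a : ℝ} (ha : a ∈ S) (h : a + ∑ t ∈ s, (f t : ℝ) < 1) :
    a + ∑ t ∈ s, (f t : ℝ) ∈ S := by
  classical
  induction s using Finset.induction_on with
  | empty => simpa using ha
  | insert x s hx ih =>
    rw [Finset.sum_insert hx] at h ⊢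
    have hpos := (hS (f x).2).1
    have := hadd _ (ih (by linarith)) _ (f x).2 (by linarith)
    convert this using 1
    ring

theorem sum_mem_of_lt_one (hadd : AddClosedBelowOne S) (hS : S ⊆ Set.Ioo 0 1) {κ : Type*}
    {s : Finset κ} (hs : s.Nonempty) (f : κ → S) (h : ∑ t ∈ s, (f t : ℝ) < 1) :
    ∑ t ∈ s, (f t : ℝ) ∈ S := by
  classical
  obtain ⟨x, hx⟩ := hs
  rw [← Finset.add_sum_erase s _ hx] at h ⊢
  exact add_sum_mem hadd hS _ f (f x).2 h

theorem HasTranslates.isPartialJSet (hadd : AddClosedBelowOne S) (hS : S ⊆ Set.Ioo 0 1)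
    {A : Set S} (hA : HasTranslates A) : IsPartialJSet A := by
  intro k f hf
  obtain ⟨F, hF, a, h⟩ := hA (Fin k) f hf
  refine ⟨F, hF, a, fun i => ?_⟩
  obtain ⟨b, hbA, hb⟩ := h i
  refine ⟨⟨_, sum_mem_of_lt_one hadd hS hF (f i) (hf i F hF).2⟩, rfl, ?_, b, ?_, hbA⟩
  · change _ + (a : ℝ) ∈ S
    rw [add_comm, ← hb]
    exact b.2
  · exact ⟨by change (a : ℝ) + _ ∈ S; rw [← hb]; exact b.2, Subtype.ext hb.symm⟩

/-- The tails of finitely many partial sequences are uniformly small. -/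
theorem exists_tail_sum_lt (hS : S ⊆ Set.Ioo 0 1) {ι : Type*} [Fintype ι] (f : ι → ℕ → S)
    (hf : ∀ i, IsPartialSequence (f i)) {ε : ℝ} (hε : 0 < ε) :
    ∃ T : ℕ, ∀ H : Finset ℕ, (∀ t ∈ H, T ≤ t) → ∑ t ∈ H, ∑ i, (f i t : ℝ) < ε := by
  have hsum : Summable fun t => ∑ i, (f i t : ℝ) := by
    refine summable_sum fun i _ => summable_of_sum_le (c := 1) (fun t => (hS (f i t).2).1.le) ?_
    intro H
    rcases H.eq_empty_or_nonempty with rfl | hH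
    · simp
    · exact (hf i H hH).2.le
  obtain ⟨s, hs⟩ := hsum.vanishing (Iio_mem_nhds hε)
  refine ⟨s.sup id + 1, fun H hH => hs H (Finset.disjoint_left.2 fun t ht hts => ?_)⟩
  have h1 := hH t ht
  have h2 : t ≤ s.sup id := Finset.le_sup (f := id) hts
  omega

theorem exists_mem_lt (hdense : Set.Ioo 0 1 ⊆ closure S) {ε : ℝ}
    (hε : 0 < ε) : ∃ a : S, (a : ℝ) < ε := by
  have hm : 0 < min ε 1 := lt_min hε one_pos
  have hmem : min ε 1 / 2 ∈ closure S :=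
    hdense ⟨by linarith, by linarith [min_le_right ε 1]⟩
  obtain ⟨y, hy, hyS⟩ := mem_closure_iff.1 hmem (Set.Iio ε) isOpen_Iio
    (by simp only [Set.mem_Iio]; linarith [min_le_left ε 1])
  exact ⟨⟨y, hyS⟩, hy⟩

theorem exists_isPartialSequence (hdense : Set.Ioo 0 1 ⊆ closure S) (hS : S ⊆ Set.Ioo 0 1) :
    ∃ f : ℕ → S, IsPartialSequence f := by
  choose f hf using fun t : ℕ =>
    exists_mem_lt hdense (ε := (1 / 2 : ℝ) / 2 / 2 ^ t) (by positivity)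
  refine ⟨f, fun H hH => ⟨Finset.sum_pos (fun t _ => (hS (f t).2).1) hH, ?_⟩⟩
  have h1 : ∑ t ∈ H, (f t : ℝ) ≤ ∑ t ∈ H, (1 / 2 : ℝ) / 2 / 2 ^ t :=
    Finset.sum_le_sum fun t _ => (hf t).le
  have h2 : ∑ t ∈ H, (1 / 2 : ℝ) / 2 / 2 ^ t ≤ 1 / 2 :=
    sum_le_hasSum H (fun t _ => by positivity) (hasSum_geometric_two' (1 / 2 : ℝ))
  linarith

theorem not_hasTranslates_empty (hdense : Set.Ioo 0 1 ⊆ closure S) (hS : S ⊆ Set.Ioo 0 1) :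
    ¬ HasTranslates (∅ : Set S) := by
  intro h
  obtain ⟨f, hf⟩ := exists_isPartialSequence hdense hS
  obtain ⟨_, _, _, h⟩ := h Unit (fun _ => f) fun _ => hf
  obtain ⟨b, hb, _⟩ := h ()
  exact hb

/-- Every neighbourhood of `0` in `S` is a partial `J`-set. -/
theorem hasTranslates_of_Ioo (hadd : AddClosedBelowOne S) (hdense : Set.Ioo 0 1 ⊆ closure S)
    (hS : S ⊆ Set.Ioo 0 1) {ε : ℝ} (hε : 0 < ε) : HasTranslates {x : S | (x : ℝ) < ε} := by
  intro ι _ f hf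
  have hm : 0 < min ε 1 := lt_min hε one_pos
  obtain ⟨T, hT⟩ := exists_tail_sum_lt hS f hf (half_pos hm)
  obtain ⟨a, ha⟩ := exists_mem_lt hdense (half_pos hm)
  refine ⟨{T}, Finset.singleton_nonempty T, a, fun i => ?_⟩
  have h1 : (f i T : ℝ) ≤ ∑ i, (f i T : ℝ) :=
    Finset.single_le_sum (f := fun i => (f i T : ℝ)) (fun j _ => (hS (f j T).2).1.le)
      (Finset.mem_univ i)
  have h2 := hT {T} (by simp)
  rw [Finset.sum_singleton] at h2 ⊢
  have h3 : (a : ℝ) + f i T < min ε 1 := by linarith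
  exact ⟨⟨_, hadd _ a.2 _ (f i T).2 (h3.trans_le (min_le_right _ _))⟩,
    h3.trans_le (min_le_left _ _), rfl⟩

/-! ### Partition regularity -/

/-- For a finite family `h` of partial sequences and a finite colouring `C` of `S`, one
colour class of a partial `J`-set `A` contains a common translate of the sums of all members of `h`. -/
theorem HasTranslates.exists_mono (hadd : AddClosedBelowOne S) (hS : S ⊆ Set.Ioo 0 1)
    {A : Set S} (hA : HasTranslates A) {κ : Type} [Finite κ] (C : S → κ)
    {α : Type} [Fintype α] [Nonempty α] (h : α → ℕ → S) (hh : ∀ i, IsPartialSequence (h i)) :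
    ∃ c : κ, ∃ F : Finset ℕ, F.Nonempty ∧ ∃ a : S, ∀ i, ∃ b ∈ A, C b = c ∧
      (b : ℝ) = a + ∑ t ∈ F, (h i t : ℝ) := by
  classical
  have hpos : ∀ i t, 0 < (h i t : ℝ) := fun i t => (hS (h i t).2).1
  obtain ⟨ι, _, hι⟩ := Combinatorics.Line.exists_mono_in_high_dimension α κ
  obtain ⟨T, hT⟩ := exists_tail_sum_lt hS h hh one_pos
  let φ : ℕ × ι → ℕ := fun p => T + Nat.pair p.1 (Fintype.equivFin ι p.2)
  have hφ : Function.Injective φ := by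
    rintro ⟨t, j⟩ ⟨t', j'⟩ hp
    have := Nat.pair_eq_pair.1 (Nat.add_left_cancel hp)
    simpa [Fin.val_inj] using this
  have hφT : ∀ p, T ≤ φ p := fun p => Nat.le_add_right _ _
  -- sums of the mixed sequences are dominated by tail sums of the whole family
  have hmix : ∀ (w : ι → α) (P : Finset (ℕ × ι)), ∑ p ∈ P, (h (w p.2) (φ p) : ℝ) < 1 := by
    intro w P
    refine lt_of_le_of_lt ?_ (hT (P.image φ) (by
      intro t ht
      obtain ⟨p, -, rfl⟩ := Finset.mem_image.1 ht
      exact hφT p))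
    rw [Finset.sum_image hφ.injOn]
    exact Finset.sum_le_sum fun p _ =>
      Finset.single_le_sum (f := fun i => (h i (φ p) : ℝ)) (fun i _ => (hpos i _).le)
        (Finset.mem_univ (w p.2))
  have hmix' : ∀ (w : ι → α) (H : Finset ℕ),
      ∑ t ∈ H, ∑ j, (h (w j) (φ (t, j)) : ℝ) < 1 := by
    intro w H
    rw [← Finset.sum_product' H Finset.univ fun t j => (h (w j) (φ (t, j)) : ℝ)]
    exact hmix w _
  obtain ⟨i₀⟩ := ‹Nonempty α›
  -- the dimension is positive: any colouring has a monochromatic line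
  have hne : Nonempty ι := by
    by_contra hemp
    rw [not_nonempty_iff] at hemp
    obtain ⟨l, _⟩ := hι fun _ => C (h i₀ 0)
    obtain ⟨j, _⟩ := l.proper
    exact hemp.elim j
  let g : (ι → α) → ℕ → S := fun w t => ⟨∑ j, (h (w j) (φ (t, j)) : ℝ),
    sum_mem_of_lt_one hadd hS Finset.univ_nonempty (fun j => h (w j) (φ (t, j)))
      (by simpa using hmix' w {t})⟩
  have hg : ∀ w, IsPartialSequence (g w) := fun w H hH =>
    ⟨Finset.sum_pos (fun t _ => (hS (g w t).2).1) hH, hmix' w H⟩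
  obtain ⟨F, hF, a, hFa⟩ := hA (ι → α) g hg
  choose b hbA hb using hFa
  obtain ⟨l, c, hl⟩ := hι fun w => C (b w)
  -- `V` is the set of active coordinates of the monochromatic line
  let V : Finset ι := Finset.univ.filter fun j => l.idxFun j = none
  have hVi : ∀ i, ∀ j ∈ V, l i j = i := by
    intro i j hj
    exact Combinatorics.Line.apply_none l i j (Finset.mem_filter.1 hj).2
  have hVc : ∀ i, ∀ j ∈ Vᶜ, l i j = l i₀ j := by
    intro i j hj
    have : l.idxFun j ≠ none := by simpa [V] using hj
    obtain ⟨y, hy⟩ := Option.ne_none_iff_exists'.1 this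
    rw [Combinatorics.Line.apply_some hy, Combinatorics.Line.apply_some hy]
  have hsplit : ∀ i, (b (l i) : ℝ) = a + ∑ p ∈ F ×ˢ Vᶜ, (h (l i₀ p.2) (φ p) : ℝ) +
      ∑ t ∈ (F ×ˢ V).image φ, (h i t : ℝ) := by
    intro i
    have h1 : ∑ p ∈ F ×ˢ Vᶜ, (h (l i₀ p.2) (φ p) : ℝ) =
        ∑ p ∈ F ×ˢ Vᶜ, (h (l i p.2) (φ p) : ℝ) :=
      Finset.sum_congr rfl fun p hp => by rw [hVc i p.2 (Finset.mem_product.1 hp).2]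
    have h2 : ∑ p ∈ F ×ˢ V, (h i (φ p) : ℝ) = ∑ p ∈ F ×ˢ V, (h (l i p.2) (φ p) : ℝ) :=
      Finset.sum_congr rfl fun p hp => by rw [hVi i p.2 (Finset.mem_product.1 hp).2]
    rw [hb, Finset.sum_image hφ.injOn, h1, h2, Finset.sum_product, Finset.sum_product,
      add_assoc, ← Finset.sum_add_distrib]
    congr 1
    refine Finset.sum_congr rfl fun t _ => ?_
    exact (Finset.sum_compl_add_sum V _).symm
  have hVne : (F ×ˢ V).Nonempty :=
    hF.product (l.proper.imp fun j hj => Finset.mem_filter.2 ⟨Finset.mem_univ j, hj⟩)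
  have ha' : (a : ℝ) + ∑ p ∈ F ×ˢ Vᶜ, (h (l i₀ p.2) (φ p) : ℝ) < 1 := by
    have h1 := hsplit i₀
    have h2 := (hS (b (l i₀)).2).2
    have h3 : 0 ≤ ∑ t ∈ (F ×ˢ V).image φ, (h i₀ t : ℝ) :=
      Finset.sum_nonneg fun t _ => (hpos i₀ t).le
    linarith
  exact ⟨c, (F ×ˢ V).image φ, hVne.image φ,
    ⟨_, add_sum_mem hadd hS (F ×ˢ Vᶜ) (fun p => h (l i₀ p.2) (φ p)) a.2 ha'⟩,
    fun i => ⟨b (l i), hbA _, hl i, hsplit i⟩⟩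

/-- Partial `J`-sets are partition regular. -/
theorem HasTranslates.or_of_union (hadd : AddClosedBelowOne S) (hS : S ⊆ Set.Ioo 0 1)
    {A B : Set S} (hAB : HasTranslates (A ∪ B)) : HasTranslates A ∨ HasTranslates B := by
  classical
  by_contra! hcon
  obtain ⟨hA, hB⟩ := hcon
  simp only [HasTranslates, not_forall] at hA hB
  obtain ⟨ι, _, f, hf, hA⟩ := hA
  obtain ⟨ι', _, f', hf', hB⟩ := hB
  obtain ⟨-, -, a, -⟩ := hAB Empty (fun i => i.elim) fun i => i.elim
  -- the empty family never witnesses failure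
  have : Nonempty ι := by
    by_contra hemp
    rw [not_nonempty_iff] at hemp
    exact hA ⟨{0}, by simp, a, fun i => hemp.elim i⟩
  obtain ⟨c, F, hF, x, hx⟩ := hAB.exists_mono hadd hS (fun b : S => b ∈ A) (Sum.elim f f')
    (by rintro (i | i); exacts [hf i, hf' i])
  by_cases hc : c
  · refine hA ⟨F, hF, x, fun i => ?_⟩
    obtain ⟨b, -, hbc, hb⟩ := hx (Sum.inl i)
    exact ⟨b, of_eq_true (hbc.trans (eq_true hc)), hb⟩
  · refine hB ⟨F, hF, x, fun i => ?_⟩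
    obtain ⟨b, hbAB, hbc, hb⟩ := hx (Sum.inr i)
    exact ⟨b, hbAB.resolve_left fun h => hc (hbc ▸ h), hb⟩

/-! ### The ideal of ultrafilters whose members are partial `J`-sets -/

/-- Some ultrafilter on `S` converging to `0` has only partial `J`-sets as members. -/
theorem exists_ultrafilter_hasTranslates (hadd : AddClosedBelowOne S)
    (hdense : Set.Ioo 0 1 ⊆ closure S) (hS : S ⊆ Set.Ioo 0 1) :
    ∃ p : Ultrafilter S, (∀ ε > 0, {x : S | (x : ℝ) < ε} ∈ p) ∧ ∀ A ∈ p, HasTranslates A := by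
  let 𝓕 : Filter S :=
    { sets := {B | ¬ HasTranslates Bᶜ}
      univ_sets := by
        simpa using not_hasTranslates_empty hdense hS
      sets_of_superset := fun {B C} hB hBC hC => hB (hC.mono (Set.compl_subset_compl.2 hBC))
      inter_sets := by
        intro B C hB hC hBC
        rw [Set.compl_inter] at hBC
        exact (hBC.or_of_union hadd hS).elim hB hC }
  have hne : NeBot (𝓕 ⊓ comap ((↑) : S → ℝ) (𝓝 0)) := by
    refine inf_neBot_iff.2 fun B hB C hC => ?_
    obtain ⟨U, hU, hUC⟩ := mem_comap.1 hC
    obtain ⟨ε, hε, hεU⟩ := Metric.mem_nhds_iff.1 hU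
    by_contra hemp
    rw [Set.not_nonempty_iff_eq_empty] at hemp
    refine hB ((hasTranslates_of_Ioo hadd hdense hS hε).mono fun x hx hxB => ?_)
    have hxC : x ∈ C := hUC (hεU (by
      rw [Metric.mem_ball, dist_zero_right, Real.norm_of_nonneg (hS x.2).1.le]
      exact hx))
    exact (hemp ▸ (⟨hxB, hxC⟩ : x ∈ B ∩ C) : x ∈ (∅ : Set S))
  have hle := Ultrafilter.of_le (𝓕 ⊓ comap ((↑) : S → ℝ) (𝓝 0))
  refine ⟨Ultrafilter.of (𝓕 ⊓ comap ((↑) : S → ℝ) (𝓝 0)), fun ε hε => ?_, fun A hA => ?_⟩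
  · exact hle (mem_inf_of_right (preimage_mem_comap (Iio_mem_nhds hε)))
  · by_contra hnot
    have hAc : Aᶜ ∈ 𝓕 := by
      change ¬ HasTranslates Aᶜᶜ
      rwa [compl_compl]
    exact Ultrafilter.compl_mem_iff_notMem.1 (hle (mem_inf_of_left hAc)) hA

theorem hasTranslates_mem_ultraMul_left {p q : Ultrafilter S}
    (hq : q ∈ delta (dotAdd S)) (hp : ∀ A ∈ p, HasTranslates A) {A : Set S}
    (hA : A ∈ ultraMul (dotAdd S) p q hq) : HasTranslates A := by
  intro ι _ f hf
  obtain ⟨F, hF, a, h⟩ := hp _ (mem_ultraMul.1 hA) ι f hf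
  choose b hbA hb using h
  -- one `t` serves all `b i` at once, and is such that `a + t` is defined
  have hall : (⋂ i, leftQuot (dotAdd S) (b i) A) ∩ R (dotAdd S) a ∈ (q : Filter S) :=
    Filter.inter_mem (Filter.iInter_mem.2 hbA) (R_mem_of_mem_delta hq a)
  obtain ⟨t, ht, hat⟩ := Filter.nonempty_of_mem hall
  refine ⟨F, hF, ⟨a + t, hat⟩, fun i => ?_⟩
  obtain ⟨c, ⟨hc, rfl⟩, hcA⟩ := Set.mem_iInter.1 ht i
  refine ⟨_, hcA, ?_⟩
  change (b i : ℝ) + t = a + t + _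
  rw [hb i]
  ring

theorem hasTranslates_mem_ultraMul_right (hadd : AddClosedBelowOne S) (hS : S ⊆ Set.Ioo 0 1)
    {p q : Ultrafilter S} (hp : p ∈ delta (dotAdd S)) (hpJ : ∀ A ∈ p, HasTranslates A)
    {A : Set S} (hA : A ∈ ultraMul (dotAdd S) q p hp) : HasTranslates A := by
  intro ι _ f hf
  obtain ⟨x, hx⟩ := Ultrafilter.nonempty_of_mem (mem_ultraMul.1 hA)
  obtain ⟨F, hF, a, h⟩ := hpJ _ hx ι f hf
  -- `x + a` need not be less than `1` when the family is empty, but then `a` itself will do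
  rcases isEmpty_or_nonempty ι with hι | ⟨⟨i₀⟩⟩
  · exact ⟨F, hF, a, fun i => hι.elim i⟩
  have hsum : ∀ i, ∃ c ∈ A, (c : ℝ) = x + a + ∑ t ∈ F, (f i t : ℝ) := by
    intro i
    obtain ⟨b, ⟨c, ⟨hc, rfl⟩, hcA⟩, hb⟩ := h i
    refine ⟨_, hcA, ?_⟩
    change (x : ℝ) + b = _
    rw [hb, add_assoc]
  obtain ⟨c, -, hc⟩ := hsum i₀
  have hxa : (x : ℝ) + a < 1 := by
    linarith [(hS c.2).2, (hf i₀ F hF).1]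
  exact ⟨F, hF, ⟨x + a, hadd _ x.2 _ a.2 hxa⟩, hsum⟩

theorem isIdeal_hasTranslates (hS : IsPartiallyNearZero S)
    (hR : ∀ x : S, R (dotAdd S) x = {y : S | (y : ℝ) ∈ Set.Ioo 0 (1 - (x : ℝ))})
    (hadd : AddClosedBelowOne S) :
    IsIdeal (deltaMul hS.isPartialSemigroup)
      {p : delta (dotAdd S) | ∀ A ∈ p.1, HasTranslates A} := by
  constructor
  · obtain ⟨p, hp0, hpJ⟩ := exists_ultrafilter_hasTranslates hadd hS.dense hS.subset
    refine ⟨⟨p, fun H _ => ?_⟩, hpJ⟩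
    rw [RFin, ← Ultrafilter.mem_coe, Filter.biInter_finset_mem]
    intro x _
    rw [hR]
    refine Filter.mem_of_superset (hp0 (1 - x) (sub_pos.2 (hS.subset x.2).2)) fun y hy => ?_
    exact ⟨(hS.subset y.2).1, hy⟩
  · intro p hp q
    exact ⟨fun A hA => hasTranslates_mem_ultraMul_right hadd hS.subset p.2 hp hA,
      fun A hA => hasTranslates_mem_ultraMul_left q.2 hp hA⟩

end NearZero

theorem mainTheorem3 (S : Set ℝ) (hS : NearZero.IsPartiallyNearZero S)
    (hR : ∀ x : S, NearZero.R (NearZero.dotAdd S) x = {y : S | (y : ℝ) ∈ Set.Ioo 0 (1 - (x : ℝ))})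
    (A : Set S) (hA : NearZero.IsPiecewiseSyndetic hS.isPartialSemigroup A) :
    NearZero.IsPartialJSet A := by
  have hadd : NearZero.AddClosedBelowOne S := by
    intro x hx y hy hxy
    have hmem : (⟨y, hy⟩ : S) ∈ NearZero.R (NearZero.dotAdd S) ⟨x, hx⟩ := by
      rw [hR]
      exact ⟨(hS.subset hy).1, lt_sub_iff_add_lt'.2 hxy⟩
    exact hmem
  obtain ⟨p, hpK, hAp⟩ := hA
  have hp := hpK _ (NearZero.isIdeal_hasTranslates hS hR hadd)
  exact (hp A hAp).isPartialJSet hadd hS.subset
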